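/- Let $K$ be a field of characteristic different from $2$ and $3$. For $\gamma\in\{1,-1\}$ let $\mathbb O=\mathbb O_\gamma$ be the octonion algebra over $K$ obtained by the Cayley--Dickson doubling with parameter $\gamma$ from the quaternion algebra $\mathbb H$ over $K$ with basis $1,i,j,k$, $i^2=j^2=k^2=-1$, $ij=-ji=k$: that is, $\mathbb O=\mathbb H\oplus\mathbb H\ell$ with $$(p+q\ell)(r+s\ell)=(pr+\gamma\,\overline s q)+(sp+q\overline r)\ell,\qquad \overline{p+q\ell}=\overline p-q\ell .$$ ($\mathbb O_1$ is the split octonion algebra; $\mathbb O_{-1}$ is the octonion algebra with the standard basis $1,e_1,\dots,e_7$, $e_i^2=-1$.) For $n\ge 1$ let $J$ be the involution $(a_{ij})\mapsto(\overline{a_{ji}})$ of the algebra $M_n(\mathbb O)$ of $n\times n$ matrices over $\mathbb O$. Consider the algebra of Hermitian matrices $\{X\in M_n(\mathbb O): J(X)=X\}$ with the product $X\circ Y=\frac12(XY+YX)$, and the algebra of skew-Hermitian matrices $\{X\in M_n(\mathbb O): J(X)=-X\}$ with the product $[X,Y]=XY-YX$. Then both algebras are central simple over $K$: each of them is simple (it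 has nonzero multiplication and no two-sided ideals other than $0$ and itself, $0$ being a proper ideal), and its centroid, i.e. the set of all maps $\varphi$ of the algebra into itself that are additive and satisfy $\varphi(xy)=\varphi(x)y=x\varphi(y)$ for all $x,y$, consists precisely of the multiplications by scalars from $K$, hence is isomorphic to $K$. -/

import Mathlib

/-! ### Nonassociative algebras with involution -/

/-- An involution on a (not necessarily associative) `K`-algebra `A`: a `K`-linear map `j : A → A`
with `j ∘ j = id` and `j (x * y) = j y * j x`. -/
structure AlgInvolution (K A : Type*) [Field K] [NonUnitalNonAssocRing A] [Module K A] where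
  toLinearMap : A →ₗ[K] A
  invol : ∀ x, toLinearMap (toLinearMap x) = x
  map_mul : ∀ x y, toLinearMap (x * y) = toLinearMap y * toLinearMap x

namespace AlgInvolution

variable {K A : Type*} [Field K] [NonUnitalNonAssocRing A] [Module K A]

/-- `sym⁺(A, j)`: the subspace of `j`-symmetric elements. -/
def symPlus (j : AlgInvolution K A) : Submodule K A where
  carrier := {x | j.toLinearMap x = x}
  add_mem' {x y} hx hy := by
    simp only [Set.mem_ofPred_eq] at *
    rw [map_add, hx, hy]
  zero_mem' := map_zero _
  smul_mem' c x hx := by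
    simp only [Set.mem_ofPred_eq] at *
    rw [map_smul, hx]

/-- `sym⁻(A, j)`: the subspace of `j`-skew-symmetric elements. -/
def symMinus (j : AlgInvolution K A) : Submodule K A where
  carrier := {x | j.toLinearMap x = -x}
  add_mem' {x y} hx hy := by
    simp only [Set.mem_ofPred_eq] at *
    rw [map_add, hx, hy, neg_add]
  zero_mem' := by simp
  smul_mem' c x hx := by
    simp only [Set.mem_ofPred_eq] at *
    rw [map_smul, hx, smul_neg]

theorem mem_symPlus {j : AlgInvolution K A} {x : A} :
    x ∈ j.symPlus ↔ j.toLinearMap x = x := Iff.rfl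

theorem mem_symMinus {j : AlgInvolution K A} {x : A} :
    x ∈ j.symMinus ↔ j.toLinearMap x = -x := Iff.rfl

/-- The product on `sym⁺(A, j)` is the anticommutator `x ∘ y = (1/2) (x y + y x)`. -/
instance (j : AlgInvolution K A) : Mul j.symPlus where
  mul x y := ⟨(2⁻¹ : K) • ((x : A) * y + (y : A) * x), by
    have hx := mem_symPlus.1 x.2
    have hy := mem_symPlus.1 y.2
    rw [mem_symPlus, map_smul, map_add, j.map_mul, j.map_mul, hx, hy, add_comm]⟩

/-- The product on `sym⁻(A, j)` is the commutator `[x, y] = x y - y x`. -/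
instance (j : AlgInvolution K A) : Mul j.symMinus where
  mul x y := ⟨(x : A) * y - (y : A) * x, by
    have hx := mem_symMinus.1 x.2
    have hy := mem_symMinus.1 y.2
    rw [mem_symMinus, map_sub, j.map_mul, j.map_mul, hx, hy]
    simp⟩

theorem coe_mul_symPlus (j : AlgInvolution K A) (x y : j.symPlus) :
    ((x * y : j.symPlus) : A) = (2⁻¹ : K) • ((x : A) * y + (y : A) * x) := rfl

theorem coe_mul_symMinus (j : AlgInvolution K A) (x y : j.symMinus) :
    ((x * y : j.symMinus) : A) = (x : A) * y - (y : A) * x := rfl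

instance (j : AlgInvolution K A) : NonUnitalNonAssocRing j.symPlus where
  left_distrib x y z := by
    ext
    simp only [coe_mul_symPlus, Submodule.coe_add, mul_add, add_mul, smul_add]
    abel
  right_distrib x y z := by
    ext
    simp only [coe_mul_symPlus, Submodule.coe_add, mul_add, add_mul, smul_add]
    abel
  zero_mul x := by ext; simp [coe_mul_symPlus]
  mul_zero x := by ext; simp [coe_mul_symPlus]

instance (j : AlgInvolution K A) : NonUnitalNonAssocRing j.symMinus where
  left_distrib x y z := by
    ext
    simp only [coe_mul_symMinus, Submodule.coe_add, mul_add, add_mul]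
    abel
  right_distrib x y z := by
    ext
    simp only [coe_mul_symMinus, Submodule.coe_add, mul_add, add_mul]
    abel
  zero_mul x := by ext; simp [coe_mul_symMinus]
  mul_zero x := by ext; simp [coe_mul_symMinus]

variable [IsScalarTower K A A] [SMulCommClass K A A]

instance (j : AlgInvolution K A) : IsScalarTower K j.symPlus j.symPlus where
  smul_assoc c x y := by
    ext
    simp only [smul_eq_mul, coe_mul_symPlus, Submodule.coe_smul, smul_mul_assoc, mul_smul_comm,
      smul_add, smul_comm c (2⁻¹ : K)]

instance (j : AlgInvolution K A) : SMulCommClass K j.symPlus j.symPlus where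
  smul_comm c x y := by
    ext
    simp only [smul_eq_mul, coe_mul_symPlus, Submodule.coe_smul, smul_mul_assoc, mul_smul_comm,
      smul_add, smul_comm c (2⁻¹ : K)]

instance (j : AlgInvolution K A) : IsScalarTower K j.symMinus j.symMinus where
  smul_assoc c x y := by
    ext
    simp only [smul_eq_mul, coe_mul_symMinus, Submodule.coe_smul, smul_mul_assoc, mul_smul_comm,
      smul_sub]

instance (j : AlgInvolution K A) : SMulCommClass K j.symMinus j.symMinus where
  smul_comm c x y := by
    ext
    simp only [smul_eq_mul, coe_mul_symMinus, Submodule.coe_smul, smul_mul_assoc, mul_smul_comm,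
      smul_sub]

end AlgInvolution

/-! ### Central simple nonassociative algebras -/

/-- A (not necessarily associative or unital) `K`-algebra `A` is central simple if it is simple,
i.e. its multiplication is nonzero and it has no two-sided ideals besides `0` and `A ≠ 0`, and if
its centroid (the maps `A → A` commuting with all left and right multiplications) consists
precisely of the multiplications by the scalars from `K`, distinct scalars giving distinct maps. -/
structure IsCentralSimpleAlg (K A : Type*) [Field K] [NonUnitalNonAssocRing A] [Module K A]
    [IsScalarTower K A A] [SMulCommClass K A A] : Prop where
  exists_mul_ne_zero : ∃ x y : A, x * y ≠ 0
  simple : IsSimpleRing A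
  central : Function.Bijective (Module.toCentroidHom : K →+* CentroidHom A)

/-! ### Octonions -/

/-- The octonion algebra over `K` obtained from the quaternion algebra `ℍ[K]` with basis
`1, i, j, k` (`i² = j² = k² = -1`) by the Cayley-Dickson doubling with parameter `γ`:
`p + q ℓ` with `p q : ℍ[K]` and `ℓ² = γ`.

For `γ = 1` the norm form `N(p) - γ N(q)` is isotropic, and this is the split octonion algebra.
For `γ = -1` this is the algebra with the standard basis `1, e₁, …, e₇`, `eᵢ² = -1`. -/
@[ext]
structure Octonion (K : Type*) [Field K] (γ : K) where
  fst : Quaternion K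
  snd : Quaternion K

namespace Octonion

variable {K : Type*} [Field K] {γ : K}

instance : Zero (Octonion K γ) := ⟨⟨0, 0⟩⟩
instance : One (Octonion K γ) := ⟨⟨1, 0⟩⟩
instance : Add (Octonion K γ) := ⟨fun x y => ⟨x.fst + y.fst, x.snd + y.snd⟩⟩
instance : Neg (Octonion K γ) := ⟨fun x => ⟨-x.fst, -x.snd⟩⟩
instance : Sub (Octonion K γ) := ⟨fun x y => ⟨x.fst - y.fst, x.snd - y.snd⟩⟩
instance {S : Type*} [SMul S (Quaternion K)] : SMul S (Octonion K γ) :=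
  ⟨fun c x => ⟨c • x.fst, c • x.snd⟩⟩

/-- `(p + q ℓ) (r + s ℓ) = (p r + γ s̄ q) + (s p + q r̄) ℓ`. -/
instance : Mul (Octonion K γ) :=
  ⟨fun x y => ⟨x.fst * y.fst + γ • (star y.snd * x.snd), y.snd * x.fst + x.snd * star y.fst⟩⟩

/-- The standard conjugation: the conjugate of `p + q ℓ` is `p̄ - q ℓ`. -/
instance : Star (Octonion K γ) := ⟨fun x => ⟨star x.fst, -x.snd⟩⟩

@[simp] theorem fst_zero : (0 : Octonion K γ).fst = 0 := rfl
@[simp] theorem snd_zero : (0 : Octonion K γ).snd = 0 := rfl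
@[simp] theorem fst_one : (1 : Octonion K γ).fst = 1 := rfl
@[simp] theorem snd_one : (1 : Octonion K γ).snd = 0 := rfl
@[simp] theorem fst_add (x y : Octonion K γ) : (x + y).fst = x.fst + y.fst := rfl
@[simp] theorem snd_add (x y : Octonion K γ) : (x + y).snd = x.snd + y.snd := rfl
@[simp] theorem fst_neg (x : Octonion K γ) : (-x).fst = -x.fst := rfl
@[simp] theorem snd_neg (x : Octonion K γ) : (-x).snd = -x.snd := rfl
@[simp] theorem fst_sub (x y : Octonion K γ) : (x - y).fst = x.fst - y.fst := rfl
@[simp] theorem snd_sub (x y : Octonion K γ) : (x - y).snd = x.snd - y.snd := rfl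
@[simp] theorem fst_smul {S : Type*} [SMul S (Quaternion K)] (c : S) (x : Octonion K γ) :
    (c • x).fst = c • x.fst := rfl
@[simp] theorem snd_smul {S : Type*} [SMul S (Quaternion K)] (c : S) (x : Octonion K γ) :
    (c • x).snd = c • x.snd := rfl
@[simp] theorem fst_mul (x y : Octonion K γ) :
    (x * y).fst = x.fst * y.fst + γ • (star y.snd * x.snd) := rfl
@[simp] theorem snd_mul (x y : Octonion K γ) :
    (x * y).snd = y.snd * x.fst + x.snd * star y.fst := rfl
@[simp] theorem fst_star (x : Octonion K γ) : (star x).fst = star x.fst := rfl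
@[simp] theorem snd_star (x : Octonion K γ) : (star x).snd = -x.snd := rfl

theorem toProd_injective :
    Function.Injective (fun x : Octonion K γ => (x.fst, x.snd)) := by
  intro x y h
  exact Octonion.ext (congrArg Prod.fst h) (congrArg Prod.snd h)

instance : AddCommGroup (Octonion K γ) :=
  toProd_injective.addCommGroup _ rfl (fun _ _ => rfl) (fun _ => rfl) (fun _ _ => rfl)
    (fun _ _ => rfl) (fun _ _ => rfl)

instance : Module K (Octonion K γ) :=
  toProd_injective.module K
    { toFun := fun x : Octonion K γ => (x.fst, x.snd), map_zero' := rfl, map_add' := fun _ _ => rfl }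
    (fun _ _ => rfl)

instance : NonAssocRing (Octonion K γ) where
  left_distrib x y z := by
    ext1 <;> simp only [fst_mul, snd_mul, fst_add, snd_add, star_add, mul_add, add_mul, smul_add] <;>
      abel
  right_distrib x y z := by
    ext1 <;> simp only [fst_mul, snd_mul, fst_add, snd_add, mul_add, add_mul, smul_add] <;>
      abel
  zero_mul x := by ext1 <;> simp
  mul_zero x := by ext1 <;> simp
  one_mul x := by ext1 <;> simp
  mul_one x := by ext1 <;> simp

instance : IsScalarTower K (Octonion K γ) (Octonion K γ) where
  smul_assoc c x y := by
    ext1 <;> simp only [smul_eq_mul, fst_mul, snd_mul, fst_smul, snd_smul, smul_mul_assoc,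
      mul_smul_comm, smul_add, smul_comm c γ]

theorem star_smul' (c : K) (x : Octonion K γ) : star (c • x) = c • star x := by
  ext1
  · simp only [fst_star, fst_smul, Quaternion.star_smul]
  · simp only [snd_star, snd_smul, smul_neg]

instance : SMulCommClass K (Octonion K γ) (Octonion K γ) where
  smul_comm c x y := by
    ext1 <;> simp only [smul_eq_mul, fst_mul, snd_mul, fst_smul, snd_smul, smul_mul_assoc,
      mul_smul_comm, smul_add, smul_comm c γ, Quaternion.star_smul]

instance : StarRing (Octonion K γ) where
  star_involutive x := by ext1 <;> simp
  star_add x y := by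
    ext1
    · simp
    · simp only [snd_star, snd_add, neg_add]
  star_mul x y := by
    ext1
    · simp [Quaternion.star_smul]
    · simp only [snd_star, snd_mul, fst_star, star_star]
      simp [add_comm]

end Octonion

/-- The involution `J : (a_{ij}) ↦ (conjugate of a_{ji})` on `M_n(𝕆)`. -/
def octonionMatrixInvolution (K : Type*) [Field K] (γ : K) (n : ℕ) :
    AlgInvolution K (Matrix (Fin n) (Fin n) (Octonion K γ)) where
  toLinearMap :=
    { toFun := fun X => X.conjTranspose
      map_add' := fun X Y => Matrix.conjTranspose_add X Y
      map_smul' := fun c X => by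
        ext1 i j
        simp [Matrix.conjTranspose_apply, Octonion.star_smul'] }
  invol X := Matrix.conjTranspose_conjTranspose X
  map_mul X Y := Matrix.conjTranspose_mul X Y

/-- The algebra `sym⁺(M_n(𝕆), J)` of Hermitian octonionic matrices with the product
`X ∘ Y = (1/2) (X Y + Y X)`. -/
abbrev HermitianOctonion (K : Type*) [Field K] (γ : K) (n : ℕ) : Type _ :=
  (octonionMatrixInvolution K γ n).symPlus

/-- The algebra `sym⁻(M_n(𝕆), J)` of skew-Hermitian octonionic matrices with the product
`[X, Y] = X Y - Y X`. -/
abbrev SkewHermitianOctonion (K : Type*) [Field K] (γ : K) (n : ℕ) : Type _ :=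
  (octonionMatrixInvolution K γ n).symMinus

/-! ### Criteria for simplicity and central simplicity -/

/-! Simplicity is shown by generating the whole algebra from any nonzero element. For the centroid
it is enough that one nonzero `e` is an eigenvector of every centroid map, by
`IsCentralSimpleAlg.of_eigenvector`.

Hermitian case: Peirce components with respect to the idempotents `e_pp` isolate one entry.
Nondegeneracy of the octonion norm form and scalarity of symmetric octonions turn it into some
`e_pp`, hence into `1` (`Matrix.one_mem_of_jordan_ideal`). A centroid map sends `e_pp` into its
Peirce 1-space, which is `K e_pp`.

Skew case: the commutator with `1 ⊗ a` acts entrywise as `[a, ·]`. The operator `projI` sends an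
octonion `o` to `16 Re(b o) i` for `b` orthogonal to `1` and `i`, so an ideal contains some `S ⊗ K
i` with `S ≠ 0` symmetric. Anticommuting octonion factors turn commutators into Jordan products, so
these `S` form a Jordan ideal of the symmetric matrices over `K`, and the Hermitian argument gives
`1 ⊗ i`. Commutators then yield every `1 ⊗ a` with `a` imaginary, and finally all skew-Hermitian
matrices. For the centroid take `e = e_pp ⊗ i`: being an image of `projI`, it goes to some `S ⊗ i`,
and the double commutator with `e_pp ⊗ j` forces `S` to be a multiple of `e_pp`. -/

theorem isSimpleRing_of_forall_mem {A : Type*} [NonUnitalNonAssocRing A] [Nontrivial A]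
    (h : ∀ (I : TwoSidedIdeal A) (x : A), x ∈ I → x ≠ 0 → ∀ y, y ∈ I) : IsSimpleRing A := by
  have : Nontrivial (TwoSidedIdeal A) := by
    obtain ⟨x, hx⟩ := exists_ne (0 : A)
    refine ⟨⊥, ⊤, fun hbt => hx ?_⟩
    rw [← TwoSidedIdeal.mem_bot, hbt]
    exact TwoSidedIdeal.mem_top A
  refine ⟨⟨fun I => ?_⟩⟩
  by_cases hI : ∃ x ∈ I, x ≠ 0
  · obtain ⟨x, hx, hx0⟩ := hI
    exact Or.inr (eq_top_iff.2 fun y _ => h I x hx hx0 y)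
  · push Not at hI
    exact Or.inl (eq_bot_iff.2 fun y hy => (TwoSidedIdeal.mem_bot A).2 (hI y hy))

/-- A simple algebra is central as soon as some nonzero element is an eigenvector of every
element of the centroid: the kernel of `φ - c` is an ideal. -/
theorem IsCentralSimpleAlg.of_eigenvector {K A : Type*} [Field K] [NonUnitalNonAssocRing A]
    [Module K A] [IsScalarTower K A A] [SMulCommClass K A A]
    (hmul : ∃ x y : A, x * y ≠ 0)
    (hsimple : ∀ (I : TwoSidedIdeal A) (x : A), x ∈ I → x ≠ 0 → ∀ y, y ∈ I)
    {e : A} (he : e ≠ 0) (heig : ∀ φ : CentroidHom A, ∃ c : K, φ e = c • e) :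
    IsCentralSimpleAlg K A where
  exists_mul_ne_zero := hmul
  simple :=
    have : Nontrivial A := ⟨e, 0, he⟩
    isSimpleRing_of_forall_mem hsimple
  central := by
    constructor
    · intro c d hcd
      have h : c • e = d • e := DFunLike.congr_fun hcd e
      exact smul_left_injective K he h
    · intro φ
      obtain ⟨c, hc⟩ := heig φ
      refine ⟨c, CentroidHom.ext fun y => ?_⟩
      let I : TwoSidedIdeal A := TwoSidedIdeal.mk' {x | φ x = c • x} (by simp)
        (fun {x y} hx hy => by
          simp only [Set.mem_ofPred_eq] at *
          rw [map_add, hx, hy, smul_add])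
        (fun {x} hx => by
          simp only [Set.mem_ofPred_eq] at *
          rw [map_neg, hx, smul_neg])
        (fun {x y} hy => by
          simp only [Set.mem_ofPred_eq] at *
          rw [map_mul_left, hy, mul_smul_comm])
        (fun {x y} hx => by
          simp only [Set.mem_ofPred_eq] at *
          rw [map_mul_right, hx, smul_mul_assoc])
      have hI : ∀ x, x ∈ I ↔ φ x = c • x := fun x => TwoSidedIdeal.mem_mk' _ _ _ _ _ _ _
      exact ((hI y).1 (hsimple I e ((hI e).2 hc) he y)).symm

/-! ### Ideals of the Jordan algebra of Hermitian matrices -/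

namespace Matrix

theorem isHermitian_single_add_single {R n : Type*} [NonAssocRing R] [StarRing R]
    [DecidableEq n] (p q : n) (b : R) :
    (single p q b + single q p (star b)).IsHermitian := by
  rw [IsHermitian, conjTranspose_add, conjTranspose_single, conjTranspose_single, star_star,
    add_comm]

theorem isHermitian_single_one {R n : Type*} [NonAssocRing R] [StarRing R] [DecidableEq n]
    (p : n) : (single p p (1 : R)).IsHermitian := by
  rw [IsHermitian, conjTranspose_single, star_one]

/-- Anticommuting with `e_pp` keeps only row and column `p`; anticommuting with `e_qq` then keeps
only the two places where these meet row and column `q`. -/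
theorem peirce_off_diagonal {R n : Type*} [NonAssocRing R] [Fintype n] [DecidableEq n]
    {p q : n} (hpq : p ≠ q) (X : Matrix n n R) :
    (X * single p p 1 + single p p 1 * X) * single q q 1 +
      single q q 1 * (X * single p p 1 + single p p 1 * X) =
      single p q (X p q) + single q p (X q p) := by
  ext r s
  simp only [add_apply, single_apply, mul_apply, ite_and, mul_ite, ite_mul, mul_one, mul_zero,
    one_mul, zero_mul, Finset.sum_ite_eq, Finset.mem_univ, if_true]
  by_cases hr : p = r <;> by_cases hs : p = s <;> by_cases hr' : q = r <;> by_cases hs' : q = s <;>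
    simp_all

/-- The anticommutator of two elements of one off-diagonal Peirce space lives at `(p, p)` and `(q,
q)`; the factor `e_pp` discards the second place. -/
theorem peirce_off_diagonal_mul {R n : Type*} [NonAssocRing R] [StarRing R] [Fintype n]
    [DecidableEq n] {p q : n} (hpq : p ≠ q) {a b : R}
    (hab : a * star b + b * star a = 1) :
    ((single p q a + single q p (star a)) * (single p q b + single q p (star b)) +
      (single p q b + single q p (star b)) * (single p q a + single q p (star a))) *
        single p p 1 + single p p 1 *
      ((single p q a + single q p (star a)) * (single p q b + single q p (star b)) +
      (single p q b + single q p (star b)) * (single p q a + single q p (star a))) =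
      single p p (1 : R) + single p p 1 := by
  simp only [mul_add, add_mul, single_mul_single_same, mul_one, one_mul,
    single_mul_single_of_ne _ _ _ _ hpq, single_mul_single_of_ne _ _ _ _ hpq.symm, zero_add,
    add_zero, ← single_add]
  rw [hab]

/-- A nonzero set of Hermitian matrices which is stable under linear combinations and under the
anticommutators with Hermitian matrices contains the identity matrix, if the symmetric elements
of `R` are scalars and the norm form of `R` is nondegenerate. -/
theorem one_mem_of_jordan_ideal {K R n : Type*} [Field K] [NonAssocRing R] [StarRing R]
    [Module K R] [Fintype n] [DecidableEq n] (h2 : (2 : K) ≠ 0)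
    (hsym : ∀ a : R, star a = a → ∃ c : K, a = c • (1 : R))
    (hform : ∀ a : R, a ≠ 0 → ∃ b, a * star b + b * star a = 1)
    (J : Matrix n n R → Prop) (hzero : J 0) (hadd : ∀ X Y, J X → J Y → J (X + Y))
    (hsmul : ∀ (c : K) X, J X → J (c • X))
    (hmul : ∀ X T, J X → T.IsHermitian → J (X * T + T * X))
    {X : Matrix n n R} (hX : X.IsHermitian) (hX0 : X ≠ 0) (hJ : J X) : J 1 := by
  have half : ∀ Y, J (Y + Y) → J Y := fun Y hY => by
    have := hsmul (2⁻¹ : K) _ hY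
    rwa [← two_smul K, smul_smul, inv_mul_cancel₀ h2, one_smul] at this
  have key : ∃ p, J (single p p 1) := by
    by_cases hoff : ∃ p q, p ≠ q ∧ X p q ≠ 0
    · obtain ⟨p, q, hpq, hne⟩ := hoff
      obtain ⟨b, hb⟩ := hform _ hne
      have h1 := hmul _ _ (hmul _ _ hJ (isHermitian_single_one p)) (isHermitian_single_one q)
      rw [peirce_off_diagonal hpq, ← hX.apply q p] at h1
      have h3 := hmul _ _ (hmul _ _ h1 (isHermitian_single_add_single p q b))
        (isHermitian_single_one p)
      rw [peirce_off_diagonal_mul hpq hb] at h3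
      exact ⟨p, half _ h3⟩
    · push Not at hoff
      have : ∃ p, X p p ≠ 0 := by
        by_contra! h
        refine hX0 (Matrix.ext fun p q => ?_)
        by_cases hpq : p = q
        · rw [hpq, h]; rfl
        · exact hoff p q hpq
      obtain ⟨p, hp⟩ := this
      obtain ⟨c, hc⟩ := hsym (X p p) (hX.apply p p)
      have hc0 : c ≠ 0 := by rintro rfl; simp [hc] at hp
      have h1 := hmul _ _ hJ (isHermitian_single_one p)
      have hpp : X * single p p 1 = single p p (X p p) := by
        ext r s
        by_cases hs : s = p
        · subst hs
          rw [mul_single_apply_same, mul_one]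
          by_cases hr : r = s
          · subst hr; simp
          · rw [hoff r s hr, single_apply_of_row_ne (Ne.symm hr)]
        · rw [mul_single_apply_of_ne _ _ _ _ _ hs, single_apply_of_col_ne _ _ (Ne.symm hs)]
      have hpp' : single p p 1 * X = single p p (X p p) := by
        ext r s
        by_cases hr : r = p
        · subst hr
          rw [single_mul_apply_same, one_mul]
          by_cases hs : s = r
          · subst hs; simp
          · rw [hoff r s (Ne.symm hs), single_apply_of_col_ne _ _ (Ne.symm hs)]
        · rw [single_mul_apply_of_ne _ _ _ _ _ hr, single_apply_of_row_ne (Ne.symm hr)]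
      rw [hpp, hpp'] at h1
      have h3 := hsmul c⁻¹ _ (half _ h1)
      rw [hc, smul_single, smul_smul, inv_mul_cancel₀ hc0, one_smul] at h3
      exact ⟨p, h3⟩
  obtain ⟨p, hp⟩ := key
  have hall : ∀ q, J (single q q 1) := by
    intro q
    by_cases hpq : p = q
    · rwa [← hpq]
    -- With `u = e_pq + e_qp`, the successive anticommutators are `u`, `2 (e_pp + e_qq)` and `4
    -- e_qq`.
    have h1 := hmul _ _ hp (isHermitian_single_add_single p q 1)
    have h3 := hmul _ _ h1 (isHermitian_single_add_single p q 1)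
    have h4 := hmul _ _ h3 (isHermitian_single_one q)
    simp only [mul_add, add_mul, single_mul_single_same, mul_one, star_one,
      single_mul_single_of_ne _ _ _ _ hpq, single_mul_single_of_ne _ _ _ _ (Ne.symm hpq), zero_add,
      add_zero] at h4
    exact half _ (half _ h4)
  rw [← sum_single_one]
  exact Finset.sum_induction _ J hadd hzero fun q _ => hall q

end Matrix

/-! ### Symmetric octonions and the norm form -/

namespace Octonion

open scoped Quaternion

variable {K : Type*} [Field K] {γ : K}

theorem ext_coord {x y : Octonion K γ} (h0 : x.fst.re = y.fst.re) (h1 : x.fst.imI = y.fst.imI)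
    (h2 : x.fst.imJ = y.fst.imJ) (h3 : x.fst.imK = y.fst.imK) (h4 : x.snd.re = y.snd.re)
    (h5 : x.snd.imI = y.snd.imI) (h6 : x.snd.imJ = y.snd.imJ) (h7 : x.snd.imK = y.snd.imK) :
    x = y :=
  Octonion.ext (Quaternion.ext _ _ h0 h1 h2 h3) (Quaternion.ext _ _ h4 h5 h6 h7)

theorem eq_zero_of_eq_neg {K : Type*} [Field K] (h2 : (2 : K) ≠ 0) {a : K} (h : a = -a) :
    a = 0 := by
  have : (2 : K) * a = 0 := by linear_combination h
  exact (mul_eq_zero.1 this).resolve_left h2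

theorem eq_smul_one_of_star_eq (h2 : (2 : K) ≠ 0) {a : Octonion K γ} (ha : star a = a) :
    a = a.fst.re • (1 : Octonion K γ) := by
  have hf := congrArg Octonion.fst ha
  have hs := congrArg Octonion.snd ha
  have f1 := congrArg QuaternionAlgebra.imI hf
  have f2 := congrArg QuaternionAlgebra.imJ hf
  have f3 := congrArg QuaternionAlgebra.imK hf
  have s0 := congrArg QuaternionAlgebra.re hs
  have s1 := congrArg QuaternionAlgebra.imI hs
  have s2 := congrArg QuaternionAlgebra.imJ hs
  have s3 := congrArg QuaternionAlgebra.imK hs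
  simp at f1 f2 f3 s0 s1 s2 s3
  apply ext_coord <;> simp [eq_zero_of_eq_neg h2 f1.symm, eq_zero_of_eq_neg h2 f2.symm,
    eq_zero_of_eq_neg h2 f3.symm, eq_zero_of_eq_neg h2 s0.symm, eq_zero_of_eq_neg h2 s1.symm,
    eq_zero_of_eq_neg h2 s2.symm, eq_zero_of_eq_neg h2 s3.symm]

/-- The polarization of the norm form of the octonions. -/
def polar (a b : Octonion K γ) : K :=
  2 * (a.fst.re * b.fst.re + a.fst.imI * b.fst.imI + a.fst.imJ * b.fst.imJ +
      a.fst.imK * b.fst.imK) -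
    2 * γ * (a.snd.re * b.snd.re + a.snd.imI * b.snd.imI + a.snd.imJ * b.snd.imJ +
      a.snd.imK * b.snd.imK)

theorem mul_star_add_mul_star (a b : Octonion K γ) :
    a * star b + b * star a = polar a b • (1 : Octonion K γ) := by
  apply ext_coord <;> simp [polar] <;> ring

theorem polar_smul_right (a b : Octonion K γ) (c : K) : polar a (c • b) = c * polar a b := by
  simp only [polar, fst_smul, snd_smul, Quaternion.re_smul, Quaternion.imI_smul,
    Quaternion.imJ_smul, Quaternion.imK_smul, smul_eq_mul]
  ring

/-- Pairing with the eight basis elements returns the coordinates of `a` up to the nonzero factors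
`2` and `-2γ`. -/
theorem exists_polar_ne_zero (h2 : (2 : K) ≠ 0) (hγ : γ ≠ 0) {a : Octonion K γ} (ha : a ≠ 0) :
    ∃ b, polar a b ≠ 0 := by
  by_contra! h
  apply ha
  have t0 := h ⟨⟨1, 0, 0, 0⟩, ⟨0, 0, 0, 0⟩⟩
  have t1 := h ⟨⟨0, 1, 0, 0⟩, ⟨0, 0, 0, 0⟩⟩
  have t2 := h ⟨⟨0, 0, 1, 0⟩, ⟨0, 0, 0, 0⟩⟩
  have t3 := h ⟨⟨0, 0, 0, 1⟩, ⟨0, 0, 0, 0⟩⟩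
  have t4 := h ⟨⟨0, 0, 0, 0⟩, ⟨1, 0, 0, 0⟩⟩
  have t5 := h ⟨⟨0, 0, 0, 0⟩, ⟨0, 1, 0, 0⟩⟩
  have t6 := h ⟨⟨0, 0, 0, 0⟩, ⟨0, 0, 1, 0⟩⟩
  have t7 := h ⟨⟨0, 0, 0, 0⟩, ⟨0, 0, 0, 1⟩⟩
  simp [polar, h2, hγ] at t0 t1 t2 t3 t4 t5 t6 t7
  exact ext_coord t0 t1 t2 t3 t4 t5 t6 t7

theorem exists_mul_star_add_mul_star_eq_one (h2 : (2 : K) ≠ 0) (hγ : γ ≠ 0) {a : Octonion K γ}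
    (ha : a ≠ 0) : ∃ b, a * star b + b * star a = 1 := by
  obtain ⟨b, hb⟩ := exists_polar_ne_zero h2 hγ ha
  refine ⟨(polar a b)⁻¹ • b, ?_⟩
  rw [mul_star_add_mul_star, polar_smul_right, inv_mul_cancel₀ hb, one_smul]

end Octonion

/-! ### The Jordan algebra of Hermitian matrices is central simple -/

namespace HermitianOctonion

open scoped Quaternion

variable {K : Type*} [Field K] {γ : K} {n : ℕ}

open Matrix

theorem coe_mul (x y : HermitianOctonion K γ n) :
    ((x * y : HermitianOctonion K γ n) : Matrix (Fin n) (Fin n) (Octonion K γ)) =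
      (2⁻¹ : K) • ((x : Matrix (Fin n) (Fin n) (Octonion K γ)) * y + y * x) := rfl

theorem conjTranspose_one_smul (c : K) :
    (c • (1 : Matrix (Fin n) (Fin n) (Octonion K γ)))ᴴ = c • 1 := by
  ext1 p q
  rw [conjTranspose_apply, Matrix.smul_apply, Matrix.smul_apply, Octonion.star_smul', one_apply, one_apply]
  by_cases h : p = q
  · simp [h]
  · simp [h, Ne.symm h]

/-- The scalar matrices as Hermitian matrices. -/
def scalar (c : K) : HermitianOctonion K γ n := ⟨c • 1, conjTranspose_one_smul c⟩

/-- A two-sided ideal is a priori only an additive subgroup; since scaling is a Jordan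
multiplication, it is a subspace. -/
theorem scalar_mul (h2 : (2 : K) ≠ 0) (c : K) (x : HermitianOctonion K γ n) :
    scalar c * x = c • x := by
  ext1
  rw [coe_mul, Submodule.coe_smul, scalar, smul_mul_assoc, mul_smul_comm, one_mul, mul_one,
    ← two_smul K, smul_smul, inv_mul_cancel₀ h2, one_smul]

theorem mem_ideal (h2 : (2 : K) ≠ 0) (hγ : γ ≠ 0) (I : TwoSidedIdeal (HermitianOctonion K γ n))
    (x : HermitianOctonion K γ n) (hx : x ∈ I) (hx0 : x ≠ 0) (y : HermitianOctonion K γ n) :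
    y ∈ I := by
  have hsmul : ∀ (c : K) (z : HermitianOctonion K γ n), z ∈ I → c • z ∈ I := fun c z hz => by
    rw [← scalar_mul h2]
    exact I.mul_mem_left _ _ hz
  have h1 := one_mem_of_jordan_ideal h2
    (fun a ha => ⟨_, Octonion.eq_smul_one_of_star_eq (γ := γ) h2 ha⟩)
    (fun a ha => Octonion.exists_mul_star_add_mul_star_eq_one h2 hγ ha)
    (fun X : Matrix (Fin n) (Fin n) (Octonion K γ) =>
      ∃ z ∈ I, (z : Matrix (Fin n) (Fin n) (Octonion K γ)) = X)
    ⟨0, I.zero_mem, rfl⟩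
    (by
      rintro _ _ ⟨z, hz, rfl⟩ ⟨w, hw, rfl⟩
      exact ⟨z + w, I.add_mem hz hw, rfl⟩)
    (by
      rintro c _ ⟨z, hz, rfl⟩
      exact ⟨c • z, hsmul c z hz, rfl⟩)
    (by
      rintro _ T ⟨z, hz, rfl⟩ hT
      refine ⟨(2 : K) • (z * ⟨T, hT⟩), hsmul _ _ (I.mul_mem_right _ _ hz), ?_⟩
      rw [Submodule.coe_smul, coe_mul, smul_smul, mul_inv_cancel₀ h2, one_smul])
    (show (x : Matrix (Fin n) (Fin n) (Octonion K γ)).IsHermitian from x.2)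
    (fun h => hx0 (Subtype.ext h)) ⟨x, hx, rfl⟩
  obtain ⟨z, hz, hz1⟩ := h1
  have hz' : z = scalar 1 := Subtype.ext (hz1.trans (one_smul K _).symm)
  rw [← one_smul K y, ← scalar_mul h2, ← hz']
  exact I.mul_mem_right _ _ hz

/-- The diagonal matrix units. -/
def unit (p : Fin n) : HermitianOctonion K γ n := ⟨single p p 1, isHermitian_single_one p⟩

theorem unit_ne_zero (p : Fin n) : (unit p : HermitianOctonion K γ n) ≠ 0 := by
  intro h
  have h1 : (single p p (1 : Octonion K γ)) p p = 0 :=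
    congrFun (congrFun (congrArg Subtype.val h) p) p
  rw [single_apply_same] at h1
  simpa using congrArg (fun a : Octonion K γ => a.fst.re) h1

theorem unit_mul_unit (h2 : (2 : K) ≠ 0) (p : Fin n) :
    (unit p * unit p : HermitianOctonion K γ n) = unit p := by
  ext1
  rw [coe_mul, unit, single_mul_single_same, mul_one, ← two_smul K, smul_smul,
    inv_mul_cancel₀ h2, one_smul]

/-- Multiplication by `e_pp` has eigenvalue `1` at `(p, p)`, `1/2` on the rest of row and column
`p`, and `0` elsewhere. The surviving entry is a symmetric octonion, hence a scalar. -/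
theorem eq_smul_unit (h2 : (2 : K) ≠ 0) {p : Fin n} {x : HermitianOctonion K γ n}
    (hx : unit p * x = x) : x = (x.1 p p).fst.re • unit p := by
  have hx' : x.1 * single p p 1 + single p p 1 * x.1 = (2 : K) • x.1 := by
    conv_rhs => rw [← hx, coe_mul, smul_smul, mul_inv_cancel₀ h2, one_smul, add_comm]
    rfl
  have hent : ∀ r s, r ≠ p ∨ s ≠ p → x.1 r s = 0 := by
    intro r s hrs
    have h := congrFun (congrFun hx' r) s
    rw [Matrix.add_apply, Matrix.smul_apply, two_smul] at h
    by_cases hr : r = p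
    · have hs : s ≠ p := hrs.resolve_left (not_not.2 hr)
      subst hr
      rw [mul_single_apply_of_ne _ _ _ _ _ hs, single_mul_apply_same, one_mul] at h
      simpa using h
    · rw [single_mul_apply_of_ne _ _ _ _ _ hr] at h
      by_cases hs : s = p
      · subst hs
        rw [mul_single_apply_same, mul_one] at h
        simpa using h
      · rw [mul_single_apply_of_ne _ _ _ _ _ hs, add_zero, ← two_smul K] at h
        exact (smul_eq_zero.1 h.symm).resolve_left h2
  ext1
  ext1 r s
  change x.1 r s = (x.1 p p).fst.re • single p p (1 : Octonion K γ) r s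
  by_cases h : r = p ∧ s = p
  · obtain ⟨rfl, rfl⟩ := h
    rw [single_apply_same]
    exact Octonion.eq_smul_one_of_star_eq h2 (IsHermitian.apply (A := x.1) x.2 _ _)
  · rw [single_apply, if_neg (fun h' : p = r ∧ p = s => h ⟨h'.1.symm, h'.2.symm⟩), smul_zero]
    exact hent r s (by tauto)

theorem isCentralSimpleAlg (h2 : (2 : K) ≠ 0) (hγ : γ ≠ 0) (hn : 1 ≤ n) :
    IsCentralSimpleAlg K (HermitianOctonion K γ n) := by
  let p : Fin n := ⟨0, hn⟩
  refine .of_eigenvector ⟨unit p, unit p, ?_⟩ (mem_ideal h2 hγ) (unit_ne_zero p) fun φ => ?_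
  · rw [unit_mul_unit h2]
    exact unit_ne_zero p
  · refine ⟨_, eq_smul_unit h2 ?_⟩
    rw [← map_mul_left, unit_mul_unit h2]

end HermitianOctonion

/-! ### Commutator identities for octonions -/

namespace Octonion

open scoped Quaternion

variable {K : Type*} [Field K] {γ : K}

/-- The multiples of the quaternion unit `i`. -/
def unitI (γ c : K) : Octonion K γ := ⟨⟨0, c, 0, 0⟩, ⟨0, 0, 0, 0⟩⟩

/-- The multiples of the quaternion unit `j`. -/
def unitJ (γ c : K) : Octonion K γ := ⟨⟨0, 0, c, 0⟩, ⟨0, 0, 0, 0⟩⟩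

/-- The multiples of the quaternion unit `k`. -/
def unitK (γ c : K) : Octonion K γ := ⟨⟨0, 0, 0, c⟩, ⟨0, 0, 0, 0⟩⟩

/-- The octonions that are orthogonal to `1` and `i`. -/
def orthI (γ : K) (v : Fin 6 → K) : Octonion K γ := ⟨⟨0, 0, v 0, v 1⟩, ⟨v 2, v 3, v 4, v 5⟩⟩

/-- The commutator of two octonions. -/
def comm (a o : Octonion K γ) : Octonion K γ := a * o - o * a

@[simp] theorem fst_re_unitI (c : K) : (unitI γ c).fst.re = 0 := rfl
@[simp] theorem fst_imI_unitI (c : K) : (unitI γ c).fst.imI = c := rfl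
@[simp] theorem fst_imJ_unitI (c : K) : (unitI γ c).fst.imJ = 0 := rfl
@[simp] theorem fst_imK_unitI (c : K) : (unitI γ c).fst.imK = 0 := rfl
@[simp] theorem snd_re_unitI (c : K) : (unitI γ c).snd.re = 0 := rfl
@[simp] theorem snd_imI_unitI (c : K) : (unitI γ c).snd.imI = 0 := rfl
@[simp] theorem snd_imJ_unitI (c : K) : (unitI γ c).snd.imJ = 0 := rfl
@[simp] theorem snd_imK_unitI (c : K) : (unitI γ c).snd.imK = 0 := rfl

@[simp] theorem fst_re_unitJ (c : K) : (unitJ γ c).fst.re = 0 := rfl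
@[simp] theorem fst_imI_unitJ (c : K) : (unitJ γ c).fst.imI = 0 := rfl
@[simp] theorem fst_imJ_unitJ (c : K) : (unitJ γ c).fst.imJ = c := rfl
@[simp] theorem fst_imK_unitJ (c : K) : (unitJ γ c).fst.imK = 0 := rfl
@[simp] theorem snd_re_unitJ (c : K) : (unitJ γ c).snd.re = 0 := rfl
@[simp] theorem snd_imI_unitJ (c : K) : (unitJ γ c).snd.imI = 0 := rfl
@[simp] theorem snd_imJ_unitJ (c : K) : (unitJ γ c).snd.imJ = 0 := rfl
@[simp] theorem snd_imK_unitJ (c : K) : (unitJ γ c).snd.imK = 0 := rfl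

@[simp] theorem fst_re_unitK (c : K) : (unitK γ c).fst.re = 0 := rfl
@[simp] theorem fst_imI_unitK (c : K) : (unitK γ c).fst.imI = 0 := rfl
@[simp] theorem fst_imJ_unitK (c : K) : (unitK γ c).fst.imJ = 0 := rfl
@[simp] theorem fst_imK_unitK (c : K) : (unitK γ c).fst.imK = c := rfl
@[simp] theorem snd_re_unitK (c : K) : (unitK γ c).snd.re = 0 := rfl
@[simp] theorem snd_imI_unitK (c : K) : (unitK γ c).snd.imI = 0 := rfl
@[simp] theorem snd_imJ_unitK (c : K) : (unitK γ c).snd.imJ = 0 := rfl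
@[simp] theorem snd_imK_unitK (c : K) : (unitK γ c).snd.imK = 0 := rfl

@[simp] theorem fst_re_orthI (v : Fin 6 → K) : (orthI γ v).fst.re = 0 := rfl
@[simp] theorem fst_imI_orthI (v : Fin 6 → K) : (orthI γ v).fst.imI = 0 := rfl
@[simp] theorem fst_imJ_orthI (v : Fin 6 → K) : (orthI γ v).fst.imJ = v 0 := rfl
@[simp] theorem fst_imK_orthI (v : Fin 6 → K) : (orthI γ v).fst.imK = v 1 := rfl
@[simp] theorem snd_re_orthI (v : Fin 6 → K) : (orthI γ v).snd.re = v 2 := rfl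
@[simp] theorem snd_imI_orthI (v : Fin 6 → K) : (orthI γ v).snd.imI = v 3 := rfl
@[simp] theorem snd_imJ_orthI (v : Fin 6 → K) : (orthI γ v).snd.imJ = v 4 := rfl
@[simp] theorem snd_imK_orthI (v : Fin 6 → K) : (orthI γ v).snd.imK = v 5 := rfl

@[simp] theorem fst_re_comm (a o : Octonion K γ) : (comm a o).fst.re =
      0 := by
  simp [comm]
  ring

@[simp] theorem fst_imI_comm (a o : Octonion K γ) : (comm a o).fst.imI =
      2 * (a.fst.imJ * o.fst.imK - a.fst.imK * o.fst.imJ + γ * (o.snd.re * a.snd.imI - a.snd.re * o.snd.imI -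
        (o.snd.imJ * a.snd.imK - o.snd.imK * a.snd.imJ))) := by
  simp [comm]
  ring

@[simp] theorem fst_imJ_comm (a o : Octonion K γ) : (comm a o).fst.imJ =
      2 * (a.fst.imK * o.fst.imI - a.fst.imI * o.fst.imK + γ * (o.snd.re * a.snd.imJ - a.snd.re * o.snd.imJ -
        (o.snd.imK * a.snd.imI - o.snd.imI * a.snd.imK))) := by
  simp [comm]
  ring

@[simp] theorem fst_imK_comm (a o : Octonion K γ) : (comm a o).fst.imK =
      2 * (a.fst.imI * o.fst.imJ - a.fst.imJ * o.fst.imI + γ * (o.snd.re * a.snd.imK - a.snd.re * o.snd.imK -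
        (o.snd.imI * a.snd.imJ - o.snd.imJ * a.snd.imI))) := by
  simp [comm]
  ring

@[simp] theorem snd_re_comm (a o : Octonion K γ) : (comm a o).snd.re =
      2 * (a.snd.imI * o.fst.imI + a.snd.imJ * o.fst.imJ + a.snd.imK * o.fst.imK -
        (o.snd.imI * a.fst.imI + o.snd.imJ * a.fst.imJ + o.snd.imK * a.fst.imK)) := by
  simp [comm]
  ring

@[simp] theorem snd_imI_comm (a o : Octonion K γ) : (comm a o).snd.imI =
      2 * (o.snd.re * a.fst.imI + o.snd.imJ * a.fst.imK - o.snd.imK * a.fst.imJ -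
        (a.snd.re * o.fst.imI + a.snd.imJ * o.fst.imK - a.snd.imK * o.fst.imJ)) := by
  simp [comm]
  ring

@[simp] theorem snd_imJ_comm (a o : Octonion K γ) : (comm a o).snd.imJ =
      2 * (o.snd.re * a.fst.imJ + o.snd.imK * a.fst.imI - o.snd.imI * a.fst.imK -
        (a.snd.re * o.fst.imJ + a.snd.imK * o.fst.imI - a.snd.imI * o.fst.imK)) := by
  simp [comm]
  ring

@[simp] theorem snd_imK_comm (a o : Octonion K γ) : (comm a o).snd.imK =
      2 * (o.snd.re * a.fst.imK + o.snd.imI * a.fst.imJ - o.snd.imJ * a.fst.imI -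
        (a.snd.re * o.fst.imK + a.snd.imI * o.fst.imJ - a.snd.imJ * o.fst.imI)) := by
  simp [comm]
  ring

/-- A combination of commutators that projects onto the multiples of `i`. -/
def projI (b o : Octonion K γ) : Octonion K γ :=
  comm b (comm (unitI γ 1) (comm (unitI γ 1) (comm (unitI γ 1) o))) +
    comm (unitI γ 1) (comm b (comm (unitI γ 1) (comm (unitI γ 1) o)))

theorem star_unitI (c : K) : star (unitI γ c) = -unitI γ c := by
  apply ext_coord <;> simp

theorem star_unitJ (c : K) : star (unitJ γ c) = -unitJ γ c := by
  apply ext_coord <;> simp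

theorem star_orthI (v : Fin 6 → K) : star (orthI γ v) = -orthI γ v := by
  apply ext_coord <;> simp

theorem star_comm {a b : Octonion K γ} (ha : star a = -a) (hb : star b = -b) :
    star (comm a b) = -comm a b := by
  simp [comm, ha, hb]

theorem smul_unitI (c d : K) : c • unitI γ d = unitI γ (c * d) := by
  apply ext_coord <;> simp

theorem unitI_ne_zero {c : K} (hc : c ≠ 0) : unitI γ c ≠ 0 := fun h =>
  hc (congrArg (fun o : Octonion K γ => o.fst.imI) h)

/-- Let `u` be the component of `o` orthogonal to `1` and `i`. Since `[i, ·]` kills `1` and `i` and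
squares to `-4` on their complement, the left side is `-4 ([b, [i, u]] + [i, [b, u]])`. By the
linearized double cross product identity the bracket is `4 ⟨b, u⟩ i`, and `⟨b, u⟩ = -Re(b o)`. -/
theorem projI_orthI (v : Fin 6 → K) (o : Octonion K γ) :
    projI (orthI γ v) o = (16 * (orthI γ v * o).fst.re) • unitI γ 1 := by
  apply ext_coord <;> simp [projI] <;> ring

/-- As `b` is imaginary, `Re(b o)` sees only the imaginary part of `o`, which `o ↦ -star o` fixes.
This makes the matrix `S` extracted from a skew-Hermitian matrix symmetric. -/
theorem re_orthI_mul_neg_star (v : Fin 6 → K) (o : Octonion K γ) :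
    (orthI γ v * -star o).fst.re = (orthI γ v * o).fst.re := by
  simp
  ring

theorem comm_comm_unitI (a : Octonion K γ) (c : K) :
    comm (comm (unitI γ 1) a) (unitI γ c) =
      (4 * c) • (a - a.fst.re • 1 - unitI γ a.fst.imI) := by
  apply ext_coord <;> simp <;> ring

/-- The first term is `-1/4` times the square of `[i, ·]`, the projection orthogonal to `1` and `i`.
In the second, `[j, ·]` moves the `i`-coordinate to `k`, where `projI` can read it. -/
theorem comm_comm_add_projI (h2 : (2 : K) ≠ 0) (o : Octonion K γ) :
    comm (unitI γ 1) (comm (unitI γ (-4⁻¹)) o) +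
        projI (orthI γ ![0, 32⁻¹, 0, 0, 0, 0]) (comm (unitJ γ 1) o) + o.fst.re • 1 = o := by
  have h4 : (4 : K) ≠ 0 := by
    have := mul_ne_zero h2 h2
    norm_num at this
    exact this
  have h32 : (32 : K) ≠ 0 := by
    have := mul_ne_zero (mul_ne_zero h4 h4) h2
    norm_num at this
    exact this
  rw [projI_orthI]
  apply ext_coord <;> simp <;> field_simp <;> ring

/-- Six imaginary coordinates are read off directly; the `i`-coordinate is seen after `[j, ·]`
carries it to `k`. -/
theorem exists_re_orthI_mul_ne_zero (h2 : (2 : K) ≠ 0) (hγ : γ ≠ 0) {o : Octonion K γ}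
    (ho : o ≠ o.fst.re • 1) :
    (∃ v, (orthI γ v * o).fst.re ≠ 0) ∨ ∃ v, (orthI γ v * comm (unitJ γ 1) o).fst.re ≠ 0 := by
  by_contra! h
  apply ho
  have t1 := h.2 ![0, 1, 0, 0, 0, 0]
  have t2 := h.1 ![1, 0, 0, 0, 0, 0]
  have t3 := h.1 ![0, 1, 0, 0, 0, 0]
  have t4 := h.1 ![0, 0, 1, 0, 0, 0]
  have t5 := h.1 ![0, 0, 0, 1, 0, 0]
  have t6 := h.1 ![0, 0, 0, 0, 1, 0]
  have t7 := h.1 ![0, 0, 0, 0, 0, 1]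
  simp [hγ] at t1 t2 t3 t4 t5 t6 t7
  have t1' : o.fst.imI = 0 := t1.resolve_left h2
  apply ext_coord <;> simp [*]

end Octonion

/-! ### Matrices of the form `S ⊗ a` and their commutators -/

namespace SkewHermitianOctonion

open Matrix Octonion
open scoped Quaternion

variable {K : Type*} [Field K] {γ : K} {n : ℕ}

/-- The matrix `S ⊗ a`. -/
def tens (S : Matrix (Fin n) (Fin n) K) (a : Octonion K γ) :
    Matrix (Fin n) (Fin n) (Octonion K γ) := S.map fun c => c • a

theorem tens_apply (S : Matrix (Fin n) (Fin n) K) (a : Octonion K γ) (p q : Fin n) :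
    tens S a p q = S p q • a := rfl

theorem tens_mul_tens (S T : Matrix (Fin n) (Fin n) K) (a b : Octonion K γ) :
    tens S a * tens T b = tens (S * T) (a * b) := by
  ext1 p q
  simp only [mul_apply, tens_apply, Finset.sum_smul, smul_mul_smul_comm]

theorem tens_one_mul (a : Octonion K γ) (X : Matrix (Fin n) (Fin n) (Octonion K γ)) (p q : Fin n) :
    (tens (n := n) 1 a * X) p q = a * X p q := by
  simp [mul_apply, tens_apply, one_apply, ite_smul, ite_mul]

theorem mul_tens_one (a : Octonion K γ) (X : Matrix (Fin n) (Fin n) (Octonion K γ)) (p q : Fin n) :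
    (X * tens (n := n) 1 a) p q = X p q * a := by
  simp [mul_apply, tens_apply, one_apply, ite_smul, mul_ite]

theorem tens_one_commutator (a : Octonion K γ) (X : Matrix (Fin n) (Fin n) (Octonion K γ)) :
    tens (n := n) 1 a * X - X * tens 1 a = X.map (comm a) := by
  ext1 p q
  rw [Matrix.sub_apply, tens_one_mul, mul_tens_one]
  rfl

theorem map_tens_comm (S : Matrix (Fin n) (Fin n) K) (a b : Octonion K γ) :
    (tens S b).map (comm a) = tens S (comm a b) := by
  ext1 p q
  simp only [map_apply, tens_apply, Octonion.comm, mul_smul_comm, smul_mul_assoc, smul_sub]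

theorem tens_conjTranspose {S : Matrix (Fin n) (Fin n) K} (hS : Sᵀ = S) {a : Octonion K γ}
    (ha : star a = -a) : (tens S a)ᴴ = -tens S a := by
  ext1 p q
  rw [conjTranspose_apply, Matrix.neg_apply, tens_apply, tens_apply, star_smul', ha, smul_neg]
  congr 2
  exact congrFun (congrFun hS p) q

/-- The sign from anticommuting octonions turns the matrix commutator into an anticommutator, which
brings in the Jordan algebra of symmetric matrices. -/
theorem commutator_tens {S T : Matrix (Fin n) (Fin n) K} {a b c : Octonion K γ} (hab : a * b = c)
    (hba : b * a = -c) : tens S a * tens T b - tens T b * tens S a = tens (S * T + T * S) c := by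
  rw [tens_mul_tens, tens_mul_tens, hab, hba]
  ext1 p q
  simp only [Matrix.sub_apply, tens_apply, Matrix.add_apply, smul_neg, add_smul, sub_neg_eq_add]

theorem commutator_tens_self (S T : Matrix (Fin n) (Fin n) K) {a b c : Octonion K γ}
    (hab : a * b = c) (hba : b * a = c) :
    tens S a * tens T b - tens T b * tens S a = tens (S * T - T * S) c := by
  rw [tens_mul_tens, tens_mul_tens, hab, hba]
  ext1 p q
  simp only [Matrix.sub_apply, tens_apply, sub_smul]

/-- The properties of the set of matrices of the elements of an ideal of the algebra of
skew-Hermitian matrices. -/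
structure IsIdealSet (M : Matrix (Fin n) (Fin n) (Octonion K γ) → Prop) : Prop where
  skew : ∀ X, M X → Xᴴ = -X
  zero : M 0
  add : ∀ X Y, M X → M Y → M (X + Y)
  left : ∀ X Y, Yᴴ = -Y → M X → M (Y * X - X * Y)
  right : ∀ X Y, Yᴴ = -Y → M X → M (X * Y - Y * X)

/-! ### Ideals of the algebra of skew-Hermitian matrices -/

namespace IsIdealSet

variable {M : Matrix (Fin n) (Fin n) (Octonion K γ) → Prop}

theorem map_comm (hM : IsIdealSet M) {X : Matrix (Fin n) (Fin n) (Octonion K γ)} (hX : M X)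
    {a : Octonion K γ} (ha : star a = -a) : M (X.map (comm a)) := by
  rw [← tens_one_commutator]
  exact hM.left _ _ (tens_conjTranspose transpose_one ha) hX

theorem map_projI (hM : IsIdealSet M) {X : Matrix (Fin n) (Fin n) (Octonion K γ)} (hX : M X)
    {b : Octonion K γ} (hb : star b = -b) : M (X.map (projI b)) := by
  have hi := star_unitI (γ := γ) (1 : K)
  have h2 := hM.map_comm (hM.map_comm hX hi) hi
  exact hM.add _ _ (hM.map_comm (hM.map_comm h2 hi) hb) (hM.map_comm (hM.map_comm h2 hb) hi)

theorem exists_entry_ne_real (hM : IsIdealSet M) (h2 : (2 : K) ≠ 0)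
    {X : Matrix (Fin n) (Fin n) (Octonion K γ)} (hX : M X) (hX0 : X ≠ 0) :
    ∃ Y, M Y ∧ ∃ p q, Y p q ≠ (Y p q).fst.re • 1 := by
  by_cases h : ∃ p q, X p q ≠ (X p q).fst.re • 1
  · exact ⟨X, hX, h⟩
  push Not at h
  obtain ⟨p, q, hpq⟩ : ∃ p q, X p q ≠ 0 := by
    by_contra! h0
    exact hX0 (Matrix.ext h0)
  have hr : (X p q).fst.re ≠ 0 := fun h0 => hpq (by rw [h, h0, zero_smul])
  have hne : q ≠ p := by
    rintro rfl
    have h1 := congrFun (congrFun (hM.skew X hX) q) q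
    rw [conjTranspose_apply, Matrix.neg_apply] at h1
    have h3 := congrArg (fun o : Octonion K γ => o.fst.re) h1
    simp only [fst_star, Quaternion.re_star, fst_neg, Quaternion.re_neg] at h3
    exact hr (eq_zero_of_eq_neg h2 h3)
  -- The commutator with `e_pp ⊗ i` has `(p, q)` entry `i X_pq`; the other product contributes
  -- nothing because `q ≠ p`.
  refine ⟨_, hM.left X (single p p (unitI γ 1)) ?_ hX, p, q, ?_⟩
  · rw [conjTranspose_single, star_unitI, single_neg]
  · rw [Matrix.sub_apply, single_mul_apply_same, mul_single_apply_of_ne _ _ _ _ _ hne, sub_zero, h]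
    intro h0
    have h3 := congrArg (fun o : Octonion K γ => o.fst.imI) h0
    simp at h3
    exact hr h3

theorem exists_tens_mem (hM : IsIdealSet M) (h2 : (2 : K) ≠ 0) (hγ : γ ≠ 0)
    {X : Matrix (Fin n) (Fin n) (Octonion K γ)} (hX : M X) (hX0 : X ≠ 0) :
    ∃ S : Matrix (Fin n) (Fin n) K, Sᵀ = S ∧ S ≠ 0 ∧ ∀ c, M (tens S (unitI γ c)) := by
  have h16 : (16 : K) ≠ 0 := by
    have := pow_ne_zero 4 h2
    norm_num at this
    exact this
  obtain ⟨Y, v, p, q, hY, hv⟩ : ∃ Y, ∃ v : Fin 6 → K, ∃ p q, M Y ∧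
      (orthI γ v * Y p q).fst.re ≠ 0 := by
    obtain ⟨Y, hY, p, q, hpq⟩ := hM.exists_entry_ne_real h2 hX hX0
    obtain ⟨v, hv⟩ | ⟨v, hv⟩ := exists_re_orthI_mul_ne_zero h2 hγ hpq
    · exact ⟨Y, v, p, q, hY, hv⟩
    · exact ⟨_, v, p, q, hM.map_comm hY (star_unitJ 1), hv⟩
  refine ⟨Y.map fun o => (orthI γ v * o).fst.re, ?_, ?_, fun c => ?_⟩
  · ext1 r s
    rw [transpose_apply, map_apply, map_apply, ← re_orthI_mul_neg_star]
    congr 3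
    have h1 := congrFun (congrFun (hM.skew Y hY) r) s
    rw [conjTranspose_apply, Matrix.neg_apply] at h1
    rw [h1, neg_neg]
  · intro h0
    exact hv (congrFun (congrFun h0 p) q)
  -- Rescaling `b` cancels the factor `16` of `projI_orthI` and supplies `c`, without assuming that
  -- the ideal is closed under scalars.
  · have h1 := hM.map_projI hY (star_orthI (γ := γ) ((16⁻¹ * c) • v))
    convert h1 using 1
    ext1 r s
    rw [tens_apply, map_apply, map_apply, projI_orthI, smul_unitI, smul_unitI]
    congr 1
    simp
    field_simp

theorem tens_one_unitI_mem (hM : IsIdealSet M) (h2 : (2 : K) ≠ 0)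
    {S : Matrix (Fin n) (Fin n) K} (hS : Sᵀ = S) (hS0 : S ≠ 0)
    (hSM : ∀ c, M (tens S (unitI γ c))) (c : K) : M (tens 1 (unitI γ c)) := by
  -- With the trivial involution on `K`, Hermitian means symmetric and the norm form is `2 a b`.
  let _ : StarRing K := starRingOfComm
  refine one_mem_of_jordan_ideal (K := K) h2 (fun a _ => ⟨a, by simp⟩) (fun a ha => ?_)
    (fun S => ∀ c, M (tens S (unitI γ c))) (fun c => ?_) (fun S T hS hT c => ?_)
    (fun d S hS c => ?_) (fun S T hS hT c => ?_) (X := S) hS hS0 hSM c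
  · refine ⟨(2 * a)⁻¹, ?_⟩
    change a * (2 * a)⁻¹ + (2 * a)⁻¹ * a = 1
    field_simp
    norm_num
  · convert hM.zero
    ext1 p q
    simp [tens_apply]
  · convert hM.add _ _ (hS c) (hT c)
    ext1 p q
    simp [tens_apply, add_smul]
  · convert hS (d * c) using 1
    ext1 p q
    simp [tens_apply, smul_unitI, mul_left_comm, mul_assoc]
  -- `[j, i] = -2k`, and then `S ⊗ (-c k)` and `T ⊗ j` have commutator `(S T + T S) ⊗ c i`.
  · have h1 := hM.map_comm (hS (c * 2⁻¹)) (star_unitJ 1)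
    rw [map_tens_comm] at h1
    have hk : comm (unitJ γ 1) (unitI γ (c * 2⁻¹)) = unitK γ (-c) := by
      apply ext_coord <;> simp
      field_simp
    rw [hk] at h1
    have hT' : Tᵀ = T := hT
    have h3 := hM.right _ _ (tens_conjTranspose (γ := γ) hT' (star_unitJ 1)) h1
    rwa [commutator_tens (c := unitI γ c)] at h3
    · apply ext_coord <;> simp
    · apply ext_coord <;> simp

/-- The bracket `[[i, a], i / 4]` is the component of `a` orthogonal to `1` and `i`; the
`i`-component is already available. -/
theorem tens_one_mem (hM : IsIdealSet M) (h2 : (2 : K) ≠ 0)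
    (h1 : ∀ c, M (tens 1 (unitI γ c))) {a : Octonion K γ} (ha : star a = -a) :
    M (tens 1 a) := by
  have h4 : (4 : K) ≠ 0 := by
    have := mul_ne_zero h2 h2
    norm_num at this
    exact this
  have hre : a.fst.re = 0 := by
    have h3 := congrArg (fun o : Octonion K γ => o.fst.re) ha
    simp only [fst_star, Quaternion.re_star, fst_neg, Quaternion.re_neg] at h3
    exact eq_zero_of_eq_neg h2 h3
  have h3 := hM.map_comm (h1 4⁻¹) (star_comm (star_unitI (γ := γ) 1) ha)
  rw [map_tens_comm, comm_comm_unitI, mul_inv_cancel₀ h4, one_smul, hre, zero_smul, sub_zero] at h3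
  convert hM.add _ _ h3 (h1 a.fst.imI) using 1
  ext1 p q
  simp [tens_apply, ← smul_add]

/-- Entrywise commutators recover the imaginary part of `X`. Its real part `A` is skew-symmetric and
comes from commutators of matrices `S ⊗ i` and `T ⊗ i` with `S`, `T` symmetric. -/
theorem mem_of_tens_one_mem (hM : IsIdealSet M) (h2 : (2 : K) ≠ 0)
    (h1 : ∀ a : Octonion K γ, star a = -a → M (tens 1 a))
    {X : Matrix (Fin n) (Fin n) (Octonion K γ)} (hX : Xᴴ = -X) : M X := by
  have hcomm : ∀ {X : Matrix (Fin n) (Fin n) (Octonion K γ)} {a : Octonion K γ}, Xᴴ = -X →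
      star a = -a → M (X.map (comm a)) := fun {X a} hX ha => by
    rw [← tens_one_commutator]
    exact hM.right _ _ hX (h1 a ha)
  have him : ∀ {X : Matrix (Fin n) (Fin n) (Octonion K γ)}, Xᴴ = -X →
      M (X.map fun o => o - o.fst.re • 1) := fun {X} hX => by
    convert hM.add _ _ (hM.map_comm (hcomm hX (star_unitI (-4⁻¹))) (star_unitI 1))
      (hM.map_projI (hcomm hX (star_unitJ 1)) (star_orthI ![0, 32⁻¹, 0, 0, 0, 0])) using 1
    ext1 p q
    exact sub_eq_of_eq_add (comm_comm_add_projI h2 (X p q)).symm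
  have htens : ∀ {T : Matrix (Fin n) (Fin n) K}, Tᵀ = T → ∀ c, M (tens T (unitI γ c)) :=
    fun {T} hT c => by
    convert him (tens_conjTranspose (γ := γ) hT (star_unitI c)) using 1
    ext1 p q
    simp [tens_apply]
  let A : Matrix (Fin n) (Fin n) K := X.map fun o => o.fst.re
  have hA : Aᵀ = -A := by
    ext1 p q
    have h3 := congrFun (congrFun hX p) q
    rw [conjTranspose_apply, Matrix.neg_apply] at h3
    have h4 : (X q p).fst.re = -(X p q).fst.re := by
      simpa using congrArg (fun o : Octonion K γ => o.fst.re) h3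
    exact h4
  have hA0 : ∀ p, A p p = 0 := fun p => by
    have h3 := congrFun (congrFun hA p) p
    exact eq_zero_of_eq_neg h2 h3
  -- For `D = e_pp` the matrix `[D, A]` is symmetric, and `[D, [D, A]] = D A + A D` because `D A D =
  -- 0`. Half of this, summed over `p`, is `A`.
  have hreal : ∀ p, M (tens ((2⁻¹ : K) • (single p p 1 * A + A * single p p 1)) 1) := fun p => by
    have hD : (single p p (1 : K))ᵀ = single p p 1 := transpose_single _ _ _
    have hT : (single p p 1 * A - A * single p p 1)ᵀ = single p p 1 * A - A * single p p 1 := by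
      rw [transpose_sub, transpose_mul, transpose_mul, hD, hA, neg_mul, mul_neg]
      abel
    have h3 := hM.left _ _ (tens_conjTranspose hD (star_unitI (γ := γ) (-2⁻¹))) (htens hT 1)
    rw [commutator_tens_self _ _ (c := (2⁻¹ : K) • 1)] at h3
    · have hDD : single p p (1 : K) * single p p 1 = single p p 1 := by
        rw [single_mul_single_same, mul_one]
      have hDAD : single p p (1 : K) * A * single p p 1 = 0 := by
        rw [single_mul_mul_single, hA0]
        simp
      have hDT : single p p 1 * (single p p 1 * A - A * single p p 1) -
          (single p p 1 * A - A * single p p 1) * single p p 1 =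
          single p p 1 * A + A * single p p 1 := by
        rw [mul_sub, sub_mul, ← mul_assoc, ← mul_assoc, hDAD, mul_assoc A, hDD]
        abel
      rw [hDT] at h3
      convert h3 using 1
      ext1 r s
      simp [tens_apply, smul_smul, mul_comm _ (2⁻¹ : K), mul_add]
    · apply ext_coord <;> simp
    · apply ext_coord <;> simp
  have hsum : M (∑ p, tens ((2⁻¹ : K) • (single p p 1 * A + A * single p p 1)) 1) :=
    Finset.sum_induction _ M hM.add hM.zero fun p _ => hreal p
  have hAsum : ∑ p, tens ((2⁻¹ : K) • (single p p 1 * A + A * single p p 1)) (1 : Octonion K γ) =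
      tens A 1 := by
    have h3 : ∑ p, (2⁻¹ : K) • (single p p 1 * A + A * single p p 1) = A := by
      rw [← Finset.smul_sum, Finset.sum_add_distrib, ← Finset.sum_mul, ← Finset.mul_sum,
        sum_single_one, one_mul, mul_one, ← two_smul K, smul_smul, inv_mul_cancel₀ h2, one_smul]
    ext1 r s
    rw [tens_apply, Matrix.sum_apply]
    simp only [tens_apply]
    rw [← Finset.sum_smul]
    congr 1
    conv_rhs => rw [← h3, Matrix.sum_apply]
  rw [hAsum] at hsum
  convert hM.add _ _ (him hX) hsum using 1
  ext1 p q
  exact (sub_add_cancel _ _).symm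

end IsIdealSet

theorem coe_mul (x y : SkewHermitianOctonion K γ n) :
    ((x * y : SkewHermitianOctonion K γ n) : Matrix (Fin n) (Fin n) (Octonion K γ)) =
      (x : Matrix (Fin n) (Fin n) (Octonion K γ)) * y - y * x := rfl

theorem mem_ideal (h2 : (2 : K) ≠ 0) (hγ : γ ≠ 0) (I : TwoSidedIdeal (SkewHermitianOctonion K γ n))
    (x : SkewHermitianOctonion K γ n) (hx : x ∈ I) (hx0 : x ≠ 0)
    (y : SkewHermitianOctonion K γ n) : y ∈ I := by
  have hM : IsIdealSet (fun X : Matrix (Fin n) (Fin n) (Octonion K γ) =>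
      ∃ z ∈ I, (z : Matrix (Fin n) (Fin n) (Octonion K γ)) = X) := by
    refine ⟨?_, ⟨0, I.zero_mem, rfl⟩, ?_, ?_, ?_⟩
    · rintro _ ⟨z, -, rfl⟩
      exact z.2
    · rintro _ _ ⟨z, hz, rfl⟩ ⟨w, hw, rfl⟩
      exact ⟨z + w, I.add_mem hz hw, rfl⟩
    · rintro _ Y hY ⟨z, hz, rfl⟩
      let w : SkewHermitianOctonion K γ n := ⟨Y, hY⟩
      exact ⟨w * z, I.mul_mem_left w z hz, coe_mul w z⟩
    · rintro _ Y hY ⟨z, hz, rfl⟩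
      let w : SkewHermitianOctonion K γ n := ⟨Y, hY⟩
      exact ⟨z * w, I.mul_mem_right z w hz, coe_mul z w⟩
  obtain ⟨S, hS, hS0, hSM⟩ := hM.exists_tens_mem h2 hγ (X := x.1) ⟨x, hx, rfl⟩
    (fun h => hx0 (Subtype.ext h))
  obtain ⟨z, hz, hzy⟩ := hM.mem_of_tens_one_mem h2
    (fun a => hM.tens_one_mem h2 (hM.tens_one_unitI_mem h2 hS hS0 hSM)) (X := y.1) y.2
  rwa [← Subtype.ext hzy]

/-! ### The centroid of the algebra of skew-Hermitian matrices -/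

/-- The matrix `S ⊗ a` as a skew-Hermitian matrix. -/
def mk (S : Matrix (Fin n) (Fin n) K) (hS : Sᵀ = S) (a : Octonion K γ) (ha : star a = -a) :
    SkewHermitianOctonion K γ n := ⟨tens S a, tens_conjTranspose hS ha⟩

theorem coe_mk_one_mul (a : Octonion K γ) (ha : star a = -a) (x : SkewHermitianOctonion K γ n) :
    (mk 1 transpose_one a ha * x).1 = x.1.map (comm a) := tens_one_commutator a x.1

/-- The operator `projI` on the skew-Hermitian matrices as a combination of multiplications. -/
def projOp (b : Octonion K γ) (hb : star b = -b) (x : SkewHermitianOctonion K γ n) :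
    SkewHermitianOctonion K γ n :=
  mk 1 transpose_one b hb * (mk 1 transpose_one _ (star_unitI 1) *
      (mk 1 transpose_one _ (star_unitI 1) * (mk 1 transpose_one _ (star_unitI 1) * x))) +
    mk 1 transpose_one _ (star_unitI 1) * (mk 1 transpose_one b hb *
      (mk 1 transpose_one _ (star_unitI 1) * (mk 1 transpose_one _ (star_unitI 1) * x)))

theorem coe_projOp (b : Octonion K γ) (hb : star b = -b) (x : SkewHermitianOctonion K γ n) :
    (projOp b hb x).1 = x.1.map (projI b) := by
  simp only [projOp, Submodule.coe_add, coe_mk_one_mul]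
  rfl

theorem centroidHom_projOp (φ : CentroidHom (SkewHermitianOctonion K γ n)) (b : Octonion K γ)
    (hb : star b = -b) (x : SkewHermitianOctonion K γ n) :
    φ (projOp b hb x) = projOp b hb (φ x) := by
  simp only [projOp, map_add, map_mul_left]

theorem commutator_unitJ_commutator_unitJ (D S : Matrix (Fin n) (Fin n) K) :
    tens D (unitJ γ 1) * (tens D (unitJ γ 1) * tens S (unitI γ 1) -
        tens S (unitI γ 1) * tens D (unitJ γ 1)) -
      (tens D (unitJ γ 1) * tens S (unitI γ 1) -
        tens S (unitI γ 1) * tens D (unitJ γ 1)) * tens D (unitJ γ 1) =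
      tens (D * (D * S + S * D) + (D * S + S * D) * D) (unitI γ (-1)) := by
  rw [commutator_tens (c := unitK γ (-1)), commutator_tens (c := unitI γ (-1))]
  all_goals apply ext_coord <;> simp

/-- The operator on the left has eigenvalues `4` at `(p, p)`, `1` on the rest of row and column `p`,
and `0` elsewhere; `4` differs from `1` exactly because `3 ≠ 0`. -/
theorem eq_smul_single (h2 : (2 : K) ≠ 0) (h3 : (3 : K) ≠ 0) {p : Fin n}
    {S : Matrix (Fin n) (Fin n) K}
    (hS : single p p 1 * (single p p 1 * S + S * single p p 1) +
      (single p p 1 * S + S * single p p 1) * single p p 1 = (4 : K) • S) :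
    S = S p p • single p p 1 := by
  have h4 : (4 : K) ≠ 0 := by
    have := mul_ne_zero h2 h2
    norm_num at this
    exact this
  ext1 r s
  have h := congrFun (congrFun hS r) s
  rw [Matrix.smul_apply, smul_eq_mul, Matrix.add_apply] at h
  rw [Matrix.smul_apply, smul_eq_mul, single_apply]
  by_cases hr : r = p <;> by_cases hs : s = p
  · simp [hr, hs]
  · subst hr
    rw [single_mul_apply_same, mul_single_apply_of_ne _ _ _ _ _ hs, Matrix.add_apply,
      single_mul_apply_same, mul_single_apply_of_ne _ _ _ _ _ hs] at h
    have : (3 : K) * S r s = 0 := by linear_combination -h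
    simp [(mul_eq_zero.1 this).resolve_left h3, Ne.symm hs]
  · subst hs
    rw [single_mul_apply_of_ne _ _ _ _ _ hr, mul_single_apply_same, Matrix.add_apply,
      single_mul_apply_of_ne _ _ _ _ _ hr, mul_single_apply_same] at h
    have : (3 : K) * S r s = 0 := by linear_combination -h
    simp [(mul_eq_zero.1 this).resolve_left h3, Ne.symm hr]
  · rw [single_mul_apply_of_ne _ _ _ _ _ hr, mul_single_apply_of_ne _ _ _ _ _ hs, add_zero] at h
    simp [(mul_eq_zero.1 h.symm).resolve_left h4, Ne.symm hs]

theorem isCentralSimpleAlg (h2 : (2 : K) ≠ 0) (h3 : (3 : K) ≠ 0) (hγ : γ ≠ 0) (hn : 1 ≤ n) :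
    IsCentralSimpleAlg K (SkewHermitianOctonion K γ n) := by
  have h4 : (4 : K) ≠ 0 := by
    have := mul_ne_zero h2 h2
    norm_num at this
    exact this
  have h16 : (16 : K) ≠ 0 := by
    have := mul_ne_zero h4 h4
    norm_num at this
    exact this
  let p : Fin n := ⟨0, hn⟩
  let D : Matrix (Fin n) (Fin n) K := single p p 1
  have hD : Dᵀ = D := transpose_single _ _ _
  let e : SkewHermitianOctonion K γ n := mk D hD _ (star_unitI 1)
  let f : SkewHermitianOctonion K γ n := mk D hD _ (star_unitJ 1)
  -- The factor is chosen so that `16 Re(j (-j / 16)) = 1`, which makes `e` the image of `e'` under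
  -- `projOp`.
  let e' : SkewHermitianOctonion K γ n := mk D hD _ (star_unitJ (-16⁻¹))
  let v : Fin 6 → K := ![1, 0, 0, 0, 0, 0]
  have he0 : e ≠ 0 := by
    intro h
    have h1 : tens D (unitI γ 1) p p = 0 := congrFun (congrFun (congrArg Subtype.val h) p) p
    rw [tens_apply, show D p p = 1 from single_apply_same _ _ _, one_smul] at h1
    exact unitI_ne_zero one_ne_zero h1
  have hffe : f * (f * e) = (-4 : K) • e := by
    ext1
    refine (commutator_unitJ_commutator_unitJ D D).trans ?_
    rw [single_mul_single_same, mul_one, mul_add, add_mul, single_mul_single_same, mul_one]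
    ext1 r s
    change tens _ _ r s = (-4 : K) • tens D (unitI γ 1) r s
    simp only [tens_apply, Matrix.add_apply, smul_unitI]
    congr 1
    ring
  have hproj : projOp (orthI γ v) (star_orthI v) e' = e := by
    ext1
    rw [coe_projOp]
    ext1 r s
    change projI (orthI γ v) (tens D (unitJ γ (-16⁻¹)) r s) = tens D (unitI γ 1) r s
    rw [projI_orthI, tens_apply, tens_apply, smul_unitI, smul_unitI]
    congr 1
    simp [v]
    field_simp
  -- Centroid maps are only additive, so the scalar `-4` is moved past `φ` as an integer.
  have hz : ∀ x : SkewHermitianOctonion K γ n, (-4 : K) • x = (-4 : ℤ) • x := fun x => by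
    rw [← Int.cast_smul_eq_zsmul K]
    norm_num
  refine .of_eigenvector ⟨f, f * e, ?_⟩ (mem_ideal h2 hγ) he0 fun φ => ?_
  · rw [hffe]
    exact smul_ne_zero (neg_ne_zero.2 h4) he0
  · let S : Matrix (Fin n) (Fin n) K := (φ e').1.map fun o => 16 * (orthI γ v * o).fst.re
    have hφ : (φ e).1 = tens S (unitI γ 1) := by
      rw [← hproj, centroidHom_projOp, coe_projOp]
      ext1 r s
      exact projI_orthI v _
    have hφ' : f * (f * φ e) = (-4 : K) • φ e := by
      rw [← map_mul_left, ← map_mul_left, hffe]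
      rw [hz, hz, map_zsmul]
    have hS : D * (D * S + S * D) + (D * S + S * D) * D = (4 : K) • S := by
      have h1 : (f * (f * φ e)).1 = _ :=
        (congrArg (fun X => tens D (unitJ γ 1) * (tens D (unitJ γ 1) * X - X * tens D (unitJ γ 1)) -
          (tens D (unitJ γ 1) * X - X * tens D (unitJ γ 1)) * tens D (unitJ γ 1)) hφ).trans
        (commutator_unitJ_commutator_unitJ D S)
      rw [hφ', Submodule.coe_smul, hφ] at h1
      ext1 r s
      have h5 := congrArg (fun o : Octonion K γ => o.fst.imI) (congrFun (congrFun h1 r) s)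
      simp [tens_apply] at h5
      rw [Matrix.smul_apply, smul_eq_mul, Matrix.add_apply]
      linear_combination h5
    refine ⟨S p p, ?_⟩
    ext1
    rw [hφ, Submodule.coe_smul]
    ext1 r s
    change tens S (unitI γ 1) r s = S p p • tens D (unitI γ 1) r s
    rw [tens_apply, tens_apply, smul_smul]
    congr 1
    exact congrFun (congrFun (eq_smul_single h2 h3 hS) r) s

end SkewHermitianOctonion

theorem mainTheorem3 (K : Type*) [Field K] (h2 : ringChar K ≠ 2) (h3 : ringChar K ≠ 3)
    (γ : K) (hγ : γ = 1 ∨ γ = -1) (n : ℕ) (hn : 1 ≤ n) :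
    IsCentralSimpleAlg K (HermitianOctonion K γ n) ∧
      IsCentralSimpleAlg K (SkewHermitianOctonion K γ n) := by
  have hγ0 : γ ≠ 0 := by rcases hγ with rfl | rfl <;> simp
  have h2' : (2 : K) ≠ 0 := Ring.two_ne_zero h2
  have h3' : (3 : K) ≠ 0 := fun h => by
    have hdvd : ringChar K ∣ 3 := (ringChar.spec K 3).1 (by exact_mod_cast h)
    rcases (Nat.dvd_prime Nat.prime_three).1 hdvd with h1 | h1
    · exact CharP.ringChar_ne_one h1
    · exact h3 h1
  exact ⟨HermitianOctonion.isCentralSimpleAlg h2' hγ0 hn,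
    SkewHermitianOctonion.isCentralSimpleAlg h2' h3' hγ0 hn⟩
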